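/- Let $m \ge 1$ and let $\mathcal M$ be a compact, connected, smooth $m$-dimensional manifold embedded in $\mathbb R^d$, with the Riemannian structure induced by $\mathbb R^d$; let $d_{\mathcal M}$ be its geodesic distance and $\mathrm{vol}_{\mathcal M}$ its Riemannian volume. Let $\mu$ be a probability measure on $\mathcal M$ with density $\rho$ with respect to $\mathrm{vol}_{\mathcal M}$, where $0<\rho_{\min}\le\rho\le\rho_{\max}<\infty$ and $\rho\in C^{2,\alpha}(\mathcal M)$ for some $\alpha\in(0,1]$. Let $A>0$. Then there are constants $c, C>0$, depending only on $\mathcal M$, $m$, $\rho$ (with its bounds) and $A$, such that the following holds for all integers $n\ge 2$ and all $\theta,\widetilde\delta>0$ with $$\widetilde\delta>\frac1{n^{1/m}},\qquad A(\theta+\widetilde\delta)\le\frac{\rho_{\min}}2 .$$ Let $x_1,\dots,x_n$ be i.i.d. samples from $\mu$ and let $\mu_n=\frac1n\sum_{i=1}^n\delta_{x_i}$. Then, with probability greater than $1-n\exp(-c\,n\,\theta^2\,\widetilde\delta^{\,m})$, there is a probability measure $\widetilde\mu_n$ on $\mathcal M$ with a density $\widetilde\rho_n:\mathcal M\to[0,\infty)$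 with respect to $\mathrm{vol}_{\mathcal M}$ such that $$\min_{T_\sharp\widetilde\mu_n=\mu_n}\ \sup_{x\in\mathcal M} d_{\mathcal M}(x,T(x))\le\widetilde\delta$$ (the minimum, over Borel maps $T:\mathcal M\to\mathcal M$ that push $\widetilde\mu_n$ forward to $\mu_n$, is attained) and $$\|\rho-\widetilde\rho_n\|_{L^\infty(\mu)}\le C(\theta+\widetilde\delta).$$ -/

import Mathlib

open MeasureTheory ProbabilityTheory Manifold
open scoped ENNReal NNReal ContDiff Topology

noncomputable section

namespace EmpiricalTransport

variable {m d : ℕ} {M : Type*} [TopologicalSpace M] [ChartedSpace (EuclideanSpace ℝ (Fin m)) M]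

/-- The geodesic distance `d_M` of the Riemannian metric that the manifold `M` inherits from `ℝ^d`
through `ι : M → ℝ^d`: the infimum of the lengths of the `C^1` paths joining the two points, where
the length of a tangent vector `v` at `x` is the Euclidean norm of `dι_x v`. -/
def geodesicEDist (ι : M → EuclideanSpace ℝ (Fin d)) (x y : M) : ℝ≥0∞ :=
  letI : ∀ p : M, ENorm (TangentSpace (𝓡 m) p) := fun p =>
    ⟨fun v => enorm (E := EuclideanSpace ℝ (Fin d)) (mfderiv (𝓡 m) (𝓡 d) ι p v)⟩
  riemannianEDist (𝓡 m) x y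

/-- `f : M → ℝ` is of class `C^{2,α}`: near every point, `f` read in the chart is `C^2` and its
second derivative is Hölder continuous with exponent `α`. -/
def IsC2Holder (m : ℕ) {M : Type*} [TopologicalSpace M]
    [ChartedSpace (EuclideanSpace ℝ (Fin m)) M] (α : ℝ≥0) (f : M → ℝ) : Prop :=
  ∀ x : M, ∃ W : Set (EuclideanSpace ℝ (Fin m)), IsOpen W ∧ extChartAt (𝓡 m) x x ∈ W ∧
    W ⊆ (extChartAt (𝓡 m) x).target ∧
    ContDiffOn ℝ 2 (f ∘ (extChartAt (𝓡 m) x).symm) W ∧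
    ∃ K : ℝ≥0, HolderOnWith K α (iteratedFDeriv ℝ 2 (f ∘ (extChartAt (𝓡 m) x).symm)) W

/-- The Riemannian volume of an `m`-dimensional manifold `M` embedded in `ℝ^d` by `ι`: the
`m`-dimensional Hausdorff measure of `ℝ^d`, normalized so that it is Lebesgue measure on `ℝ^m`,
carried by the image of `ι`. -/
def volM (m : ℕ) {d : ℕ} {M : Type*} [MeasurableSpace M] (ι : M → EuclideanSpace ℝ (Fin d)) :
    Measure M :=
  Measure.comap ι (μHE[m] : Measure (EuclideanSpace ℝ (Fin d)))

/-- The measure on `M` with density `ρ` with respect to the Riemannian volume. -/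
def densityMeasure (m : ℕ) {d : ℕ} {M : Type*} [MeasurableSpace M]
    (ι : M → EuclideanSpace ℝ (Fin d)) (ρ : M → ℝ) : Measure M :=
  (volM m ι).withDensity fun x => ENNReal.ofReal (ρ x)

/-- The empirical measure `(1/n) ∑ δ_{x_i}`. -/
def empiricalMeasure {M : Type*} [MeasurableSpace M] {n : ℕ} (x : Fin n → M) : Measure M :=
  (n : ℝ≥0∞)⁻¹ • ∑ i, Measure.dirac (x i)

/-- `T` is a (Borel) map with `T_♯ μ = ν`. -/
def IsTransportMap {M : Type*} [MeasurableSpace M] (μ ν : Measure M) (T : M → M) : Prop :=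
  Measurable T ∧ Measure.map T μ = ν

/-- The largest displacement `sup_x d_M(x, T x)` of a map `T : M → M`. -/
def maxDisplacement (ι : M → EuclideanSpace ℝ (Fin d)) (T : M → M) : ℝ≥0∞ :=
  ⨆ x : M, geodesicEDist (m := m) ι x (T x)

end EmpiricalTransport

end

/-!
Outside an event of small probability, the density `ρ'` is obtained from `ρ` by rescaling it on each
cell of a partition of `M` so that the cell receives exactly its empirical mass.

* *Partition.* Geodesic balls of radius `s` have mass at least a constant times `s ^ m`, uniformly
  in the centre (`exists_densityMeasure_ball_ge`): an immersion chart is the restriction of a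
  Lipschitz map of the ambient space, which bounds Hausdorff measure from below, and coordinate
  segments bound the geodesic distance from above. A maximal disjoint family of balls of radius
  comparable to `δ` therefore yields a partition of `M` into `N ≤ const / δ ^ m` cells of diameter
  at most `δ` and mass at least `const * δ ^ m` (`exists_partition`).
* *Concentration.* By Chernoff's bound (`measure_frequency_sub_gt_le`) and a union bound, all cells
  have empirical frequencies with relative error at most `θ`, except with probability
  `2 N exp (-b n θ² δ ^ m)`. Since `δ ^ m > 1 / n`, this is at most `a n exp (-b n θ² δ ^ m)`. The
  factor `a` is absorbed into the rate (`exists_rate_absorb`): if `n θ² δ ^ m` is bounded, a small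
  rate makes `n exp (-c n θ² δ ^ m) > 1` because `n ≥ 2`, and nothing has to be proved.
* *Transport.* On the good event the rescaled density differs from `ρ` by at most `ρmax * θ`. As it
  gives each cell its empirical mass and has no atoms, it can be transported to the empirical measure
  within the cells, so by a distance of at most `δ` (`IsDiffuse.exists_transport_of_plan`).
* *Attainment.* The minimal displacement is attained because a limit of the transport plans of a
  minimizing sequence, discretized by the sets of targets within the infimal distance, is again
  realized by a map (`IsDiffuse.exists_isLeast_displacement`).
-/

namespace EmpiricalTransport

/-! ### Transport of a diffuse measure to a finitely supported one -/

section Diffuse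

variable {X : Type*} [MeasurableSpace X]

/-- A measure is diffuse if some measurable real function has only null level sets. This form of
atomlessness gives the intermediate value property of the measure at once, by continuity of the
distribution function. -/
def IsDiffuse (μ : Measure X) : Prop :=
  ∃ g : X → ℝ, Measurable g ∧ ∀ t, μ (g ⁻¹' {t}) = 0

lemma IsDiffuse.mono {μ ν : Measure X} (h : IsDiffuse μ) (hν : ν ≪ μ) : IsDiffuse ν := by
  obtain ⟨g, hg, hg0⟩ := h
  exact ⟨g, hg, fun t => hν (hg0 t)⟩

lemma IsDiffuse.exists_subset_measure_eq {μ : Measure X} [IsFiniteMeasure μ] (h : IsDiffuse μ)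
    {C : Set X} (hC : MeasurableSet C) {w : ℝ≥0∞} (hw : w ≤ μ C) :
    ∃ S, MeasurableSet S ∧ S ⊆ C ∧ μ S = w := by
  obtain ⟨g, hg, hg0⟩ := h
  rcases eq_or_ne w 0 with rfl | hw0
  · exact ⟨∅, .empty, by simp, by simp⟩
  rcases hw.eq_or_lt with rfl | hwC
  · exact ⟨C, hC, subset_rfl, rfl⟩
  set ν := (μ.restrict C).map g with hν
  have hνapp : ∀ s, MeasurableSet s → ν s = μ (C ∩ g ⁻¹' s) := fun s hs => by
    rw [hν, Measure.map_apply hg hs, Measure.restrict_apply (hg hs), Set.inter_comm]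
  have huniv : ν Set.univ = μ C := by simp [hνapp _ MeasurableSet.univ]
  have : NullSingletonClass ν := ⟨fun t => by
    rw [hνapp _ (measurableSet_singleton t)]
    exact measure_mono_null Set.inter_subset_right (hg0 t)⟩
  have hcont : Continuous fun t => ν.real (Set.Iic t) := by
    have h1 : ∀ a b, IntervalIntegrable (fun _ : ℝ => (1 : ℝ)) ν a b := fun a b => by simp
    have h2 := intervalIntegral.continuous_primitive h1 0
    have h3 : (fun t => ν.real (Set.Iic t)) =
        fun t => ν.real (Set.Iic 0) + ∫ _ in (0 : ℝ)..t, (1 : ℝ) ∂ν := by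
      funext t
      rw [← intervalIntegral.integral_Iic_sub_Iic (by simp) (by simp)]
      simp
    rw [h3]
    exact continuous_const.add h2
  have hwtop : w ≠ ⊤ := ne_top_of_lt hwC
  have hhi : ∃ b, w.toReal ≤ ν.real (Set.Iic b) := by
    have := (tendsto_order.1 (tendsto_measure_Iic_atTop ν)).1 w (by rwa [huniv])
    obtain ⟨b, hb⟩ := this.exists
    exact ⟨b, ENNReal.toReal_mono (measure_ne_top _ _) hb.le⟩
  have hlo : ∃ a, ν.real (Set.Iic a) ≤ w.toReal := by
    have := (tendsto_order.1 (tendsto_measure_Ici_atBot ν)).1 (ν Set.univ - w)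
      (ENNReal.sub_lt_self (measure_ne_top _ _)
        (by rw [huniv]; exact (hw0.bot_lt.trans hwC).ne') hw0)
    obtain ⟨a, ha⟩ := this.exists
    refine ⟨a, ENNReal.toReal_mono hwtop ?_⟩
    rw [← measure_congr (Iio_ae_eq_Iic (a := a) (μ := ν)), ← Set.compl_Ici,
      measure_compl measurableSet_Ici (measure_ne_top _ _)]
    exact tsub_le_iff_tsub_le.1 ha.le
  obtain ⟨t, ht⟩ := mem_range_of_exists_le_of_exists_ge hcont hlo hhi
  refine ⟨C ∩ g ⁻¹' Set.Iic t, hC.inter (hg measurableSet_Iic), Set.inter_subset_left, ?_⟩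
  rw [← hνapp _ measurableSet_Iic]
  exact (ENNReal.toReal_eq_toReal_iff' (measure_ne_top _ _) hwtop).1 ht

lemma IsDiffuse.exists_disjoint_subsets {μ : Measure X} [IsFiniteMeasure μ] (h : IsDiffuse μ)
    {κ : Type*} (s : Finset κ) (w : κ → ℝ≥0∞) {C : Set X} (hC : MeasurableSet C)
    (hw : ∑ i ∈ s, w i ≤ μ C) :
    ∃ S : κ → Set X, (∀ i, MeasurableSet (S i)) ∧ (∀ i, S i ⊆ C) ∧
      Pairwise (Function.onFun Disjoint S) ∧ (∀ i ∈ s, μ (S i) = w i) ∧ ∀ i ∉ s, S i = ∅ := by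
  classical
  induction s using Finset.induction_on generalizing C with
  | empty => exact ⟨fun _ => ∅, by simp, by simp, fun i j _ => by simp [Function.onFun], by simp,
      by simp⟩
  | insert a s ha ih =>
    rw [Finset.sum_insert ha] at hw
    obtain ⟨A, hA, hAC, hμA⟩ := h.exists_subset_measure_eq hC (le_self_add.trans hw)
    have hrest : ∑ i ∈ s, w i ≤ μ (C \ A) := by
      rw [measure_sdiff hAC hA.nullMeasurableSet (measure_ne_top _ _), hμA]
      exact ENNReal.le_sub_of_add_le_left (hμA ▸ measure_ne_top _ _) hw
    obtain ⟨S, hS, hSC, hSd, hSw, hS0⟩ := ih (hC.diff hA) hrest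
    have hAS : ∀ i, Disjoint A (S i) := fun i =>
      Set.disjoint_of_subset_right (hSC i) Set.disjoint_sdiff_right
    refine ⟨Function.update S a A, fun i => ?_, fun i => ?_, fun i j hij => ?_, fun i hi => ?_,
      fun i hi => ?_⟩
    · rcases eq_or_ne i a with rfl | hia <;> simp_all
    · rcases eq_or_ne i a with rfl | hia
      · simpa using hAC
      · simpa [hia] using (hSC i).trans Set.sdiff_subset
    · rcases eq_or_ne i a with rfl | hia
      · simpa [Function.onFun, hij.symm] using hAS j
      · rcases eq_or_ne j a with rfl | hja
        · simpa [Function.onFun, hij] using (hAS i).symm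
        · simpa [Function.onFun, hia, hja] using hSd hij
    · rcases eq_or_ne i a with rfl | hia
      · simpa using hμA
      · simpa [hia] using hSw i ((Finset.mem_insert.1 hi).resolve_left hia)
    · rw [Finset.mem_insert, not_or] at hi
      simpa [hi.1] using hS0 i hi.2

/-- A transport plan between the cells of a partition and the points of a finite set is realized by
a transport map: the map sends a piece of the cell `c a` of mass `w a y` to the point `y`. The map
is the identity on the null set that the pieces may leave over. -/
lemma IsDiffuse.exists_transport_of_plan [MeasurableSingletonClass X] {μ ν : Measure X}
    [IsFiniteMeasure μ] (h : IsDiffuse μ) (hμν : μ Set.univ = ν Set.univ) {Y : Finset X}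
    (hY : ν (Y : Set X)ᶜ = 0) {κ : Type*} [Fintype κ] {c : κ → Set X}
    (hc : ∀ a, MeasurableSet (c a)) (hcd : Pairwise (Function.onFun Disjoint c))
    (w : κ → X → ℝ≥0∞) (hrow : ∀ a, ∑ y ∈ Y, w a y = μ (c a))
    (hcol : ∀ y ∈ Y, ∑ a, w a y = ν {y}) :
    ∃ T : X → X, IsTransportMap μ ν T ∧
      ∀ x, T x = x ∨ ∃ a, ∃ y ∈ Y, x ∈ c a ∧ T x = y ∧ w a y ≠ 0 := by
  classical
  have hS : ∀ a, ∃ S : X → Set X, (∀ i, MeasurableSet (S i)) ∧ (∀ i, S i ⊆ c a) ∧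
      Pairwise (Function.onFun Disjoint S) ∧
      (∀ i ∈ Y.filter (w a · ≠ 0), μ (S i) = w a i) ∧ ∀ i ∉ Y.filter (w a · ≠ 0), S i = ∅ :=
    fun a => h.exists_disjoint_subsets _ _ (hc a)
      (by rw [Finset.sum_filter_ne_zero]; exact (hrow a).le)
  choose S hSm hSc hSd hSw hS0 using hS
  have hSμ : ∀ a, ∀ y ∈ Y, μ (S a y) = w a y := fun a y hy => by
    by_cases hw : w a y = 0
    · rw [hS0 a y (by simp [hw]), hw, measure_empty]
    · exact hSw a y (by simp [hy, hw])
  have hSmem : ∀ a y x, x ∈ S a y → y ∈ Y ∧ w a y ≠ 0 := fun a y x hx => by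
    by_contra hcon
    rw [hS0 a y (by simpa using hcon)] at hx
    exact hx
  have hdisj : ∀ a y a' y' x, x ∈ S a y → x ∈ S a' y' → a = a' ∧ y = y' := by
    intro a y a' y' x hx hx'
    have haa : a = a' := by
      by_contra hne
      exact Set.disjoint_left.1 (hcd hne) (hSc _ _ hx) (hSc _ _ hx')
    subst haa
    refine ⟨rfl, ?_⟩
    by_contra hne
    exact Set.disjoint_left.1 (hSd a hne) hx hx'
  let t : Option (κ × Y) → Set X := fun o =>
    o.elim (⋃ p : κ × Y, S p.1 p.2)ᶜ fun p => S p.1 p.2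
  let f : Option (κ × Y) → X → X := fun o => o.elim id fun p _ => p.2
  obtain ⟨T, hT, hTe⟩ := exists_measurable_piecewise t
    (by
      rintro (_ | p)
      · exact (MeasurableSet.iUnion fun p => hSm _ _).compl
      · exact hSm _ _)
    f
    (by
      rintro (_ | p)
      · exact measurable_id
      · exact measurable_const)
    (by
      rintro (_ | p) (_ | q) hpq x ⟨hx, hx'⟩
      · rfl
      · exact absurd (Set.mem_iUnion.2 ⟨q, hx'⟩) hx
      · exact absurd (Set.mem_iUnion.2 ⟨p, hx⟩) hx'
      · obtain ⟨-, h2⟩ := hdisj _ _ _ _ _ hx hx'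
        exact h2)
  have hTS : ∀ a y x, x ∈ S a y → T x = y := fun a y x hx =>
    hTe (some (a, ⟨y, (hSmem a y x hx).1⟩)) hx
  refine ⟨T, ⟨hT, ?_⟩, fun x => ?_⟩
  · -- `ν ≤ T_♯ μ` holds by construction, and the two measures have the same finite mass.
    have : IsFiniteMeasure ν := ⟨by rw [← hμν]; exact measure_lt_top _ _⟩
    symm
    refine Measure.eq_of_le_of_measure_univ_eq (Measure.le_iff.2 fun s hs => ?_) ?_
    · rw [Measure.map_apply hT hs]
      calc ν s ≤ ν ((Y.filter (· ∈ s) : Finset X) : Set X) := by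
            refine (measure_mono (t := ((Y.filter (· ∈ s) : Finset X) : Set X) ∪ (Y : Set X)ᶜ)
              fun x hx => ?_).trans ((measure_union_le _ _).trans (by simp [hY]))
            by_cases hxY : x ∈ Y <;> simp [hxY, hx]
        _ = ∑ y ∈ Y.filter (· ∈ s), ∑ a, μ (S a y) := by
            rw [← sum_measure_singleton]
            refine Finset.sum_congr rfl fun y hy => ?_
            have hyY := (Finset.mem_filter.1 hy).1
            rw [← hcol y hyY]
            exact Finset.sum_congr rfl fun a _ => (hSμ a y hyY).symm
        _ = μ (⋃ p ∈ (Y.filter (· ∈ s)) ×ˢ (Finset.univ : Finset κ), S p.2 p.1) := by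
            rw [measure_biUnion_finset, Finset.sum_product]
            · rintro ⟨y, a⟩ - ⟨y', a'⟩ - hne
              refine Set.disjoint_left.2 fun x hx hx' => hne ?_
              obtain ⟨h1, h2⟩ := hdisj _ _ _ _ _ hx hx'
              simp only at h1 h2
              rw [h1, h2]
            · exact fun p _ => hSm _ _
        _ ≤ μ (T ⁻¹' s) := by
            refine measure_mono (Set.iUnion₂_subset fun p hp x hx => ?_)
            rw [Set.mem_preimage, hTS _ _ _ hx]
            exact (Finset.mem_filter.1 (Finset.mem_product.1 hp).1).2
    · rw [Measure.map_apply hT .univ, Set.preimage_univ, hμν]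
  · by_cases hx : x ∈ ⋃ p : κ × Y, S p.1 p.2
    · obtain ⟨⟨a, y⟩, hp⟩ := Set.mem_iUnion.1 hx
      exact .inr ⟨a, y, y.2, hSc _ _ hp, hTS _ _ _ hp, (hSmem _ _ _ hp).2⟩
    · exact .inl (hTe none hx)

/-- Bottleneck-optimal transport maps exist from a diffuse measure to a finitely supported one. Along
a minimizing sequence `T k`, the masses that `T k` sends to `y` from the cells on which the set of
targets within the infimal distance is constant form a bounded matrix. A subsequential limit is a
transport plan that no longer uses pairs beyond the infimal distance, because the mass it could use
there lies in a decreasing family of sets with empty intersection. -/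
lemma IsDiffuse.exists_isLeast_displacement [MeasurableSingletonClass X] {μ ν : Measure X}
    [IsFiniteMeasure μ] (h : IsDiffuse μ) {Y : Finset X} (hY : ν (Y : Set X)ᶜ = 0)
    {D : X → X → ℝ≥0∞} (hD0 : ∀ x, D x x = 0) (hD : ∀ y, Measurable fun x => D x y)
    (hne : ∃ T, IsTransportMap μ ν T) :
    ∃ r, IsLeast ((fun T : X → X => ⨆ x, D x (T x)) '' {T | IsTransportMap μ ν T}) r := by
  classical
  set 𝒮 := (fun T : X → X => ⨆ x, D x (T x)) '' {T | IsTransportMap μ ν T}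
  have h𝒮 : 𝒮.Nonempty := Set.Nonempty.image _ hne
  obtain ⟨u, hu, hulim, hu𝒮⟩ := exists_seq_tendsto_sInf h𝒮 (OrderBot.bddBelow _)
  set r := sInf 𝒮
  choose T hT hTu using hu𝒮
  have hTD : ∀ k x, D x (T k x) ≤ u k := fun k x => by
    rw [← hTu k]; exact le_iSup (fun x => D x (T k x)) x
  have hmass : μ Set.univ = ν Set.univ := by
    rw [← (hT 0).2, Measure.map_apply (hT 0).1 .univ, Set.preimage_univ]
  let c : Set Y → Set X := fun I => {x | ∀ y : Y, D x y ≤ r ↔ y ∈ I}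
  have hc : ∀ I, MeasurableSet (c I) := fun I => by
    have : c I = ⋂ y : Y, {x | D x y ≤ r ↔ y ∈ I} := by ext; simp [c]
    rw [this]
    refine MeasurableSet.iInter fun y => ?_
    have hm : MeasurableSet {x | D x y ≤ r} := hD y measurableSet_Iic
    by_cases hy : y ∈ I
    · simpa [hy] using hm
    · simp only [hy, iff_false]
      exact hm.compl
  have hcd : Pairwise (Function.onFun Disjoint c) := fun I J hIJ =>
    Set.disjoint_left.2 fun x hI hJ => hIJ (Set.ext fun y => (hI y).symm.trans (hJ y))
  have hcmem : ∀ x, x ∈ c {y | D x y ≤ r} := fun x y => Iff.rfl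
  let w : ℕ → Set Y → X → ℝ≥0∞ := fun k I y => μ (c I ∩ T k ⁻¹' {y})
  have hrow : ∀ k I, ∑ y ∈ Y, w k I y = μ (c I) := fun k I => by
    have h0 : μ (c I \ T k ⁻¹' (Y : Set X)) = 0 := by
      refine measure_mono_null (t := T k ⁻¹' (Y : Set X)ᶜ) (fun x hx => hx.2) ?_
      rw [← Measure.map_apply (hT k).1 Y.measurableSet.compl, (hT k).2, hY]
    rw [← measure_inter_add_sdiff (c I) ((hT k).1 Y.measurableSet), h0, add_zero,
      ← measure_biUnion_finset]
    · congr 1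
      ext x
      simp
    · intro y _ y' _ hne
      exact Set.disjoint_left.2 fun x hx hx' => hne (hx.2.symm.trans hx'.2)
    · exact fun y _ => (hc I).inter ((hT k).1 (measurableSet_singleton y))
  have hcol : ∀ k y, ∑ I, w k I y = ν {y} := fun k y => by
    rw [← (hT k).2, Measure.map_apply (hT k).1 (measurableSet_singleton y),
      ← measure_biUnion_finset]
    · congr 1
      ext x
      simpa using fun _ => ⟨_, hcmem x⟩
    · exact fun I _ J _ hne => (hcd hne).mono Set.inter_subset_left Set.inter_subset_left
    · exact fun I _ => (hc I).inter ((hT k).1 (measurableSet_singleton y))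
  obtain ⟨W, φ, hφ, hW⟩ := CompactSpace.tendsto_subseq fun k (I : Set Y) (y : Y) => w k I y
  have hWlim : ∀ I (y : Y), Filter.Tendsto (fun k => w (φ k) I y) Filter.atTop (𝓝 (W I y)) :=
    fun I y => tendsto_pi_nhds.1 (tendsto_pi_nhds.1 hW I) y
  have hW0 : ∀ I (y : Y), y ∉ I → W I y = 0 := fun I y hy => by
    let V : ℕ → Set X := fun k => {x | r < D x y ∧ D x y ≤ u k}
    have hV : Filter.Tendsto (fun k => μ (V k)) Filter.atTop (𝓝 0) := by
      have h1 := tendsto_measure_iInter_atTop (μ := μ) (s := V)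
        (fun k => ((hD y measurableSet_Ioi).inter (hD y measurableSet_Iic)).nullMeasurableSet)
        (fun k l hkl x hx => ⟨hx.1, hx.2.trans (hu hkl)⟩) ⟨0, measure_ne_top _ _⟩
      have h2 : ⋂ k, V k = ∅ := by
        refine Set.eq_empty_of_forall_notMem fun x hx => ?_
        rw [Set.mem_iInter] at hx
        exact absurd (ge_of_tendsto' hulim fun k => (hx k).2) (hx 0).1.not_ge
      rwa [h2, measure_empty] at h1
    refine tendsto_nhds_unique (hWlim I y)
      (tendsto_of_tendsto_of_tendsto_of_le_of_le tendsto_const_nhds (hV.comp hφ.tendsto_atTop)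
        (fun _ => zero_le) fun k => measure_mono fun x hx => ?_)
    have hxT : T (φ k) x = y := hx.2
    exact ⟨lt_of_not_ge fun hle => hy ((hx.1 y).1 hle), hxT ▸ hTD (φ k) x⟩
  let W' : Set Y → X → ℝ≥0∞ := fun I y => if hy : y ∈ Y then W I ⟨y, hy⟩ else 0
  have hW'lim : ∀ I, ∀ y ∈ Y, Filter.Tendsto (fun k => w (φ k) I y) Filter.atTop (𝓝 (W' I y)) :=
    fun I y hy => by simpa [W', hy] using hWlim I ⟨y, hy⟩
  obtain ⟨T', hT', hT'x⟩ := h.exists_transport_of_plan hmass hY hc hcd W'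
    (fun I => tendsto_nhds_unique (tendsto_finsetSum Y fun y hy => hW'lim I y hy)
      (by simp only [hrow]; exact tendsto_const_nhds))
    (fun y hy => tendsto_nhds_unique (tendsto_finsetSum Finset.univ fun I _ => hW'lim I y hy)
      (by simp only [hcol]; exact tendsto_const_nhds))
  refine ⟨r, ?_, fun s hs => sInf_le hs⟩
  refine ⟨T', hT', le_antisymm (iSup_le fun x => ?_) (sInf_le ⟨T', hT', rfl⟩)⟩
  rcases hT'x x with hx | ⟨I, y, hy, hxc, hx, hne⟩
  · simp [hx, hD0]
  · rw [hx]
    refine (hxc ⟨y, hy⟩).2 ?_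
    by_contra hyI
    exact hne (by simp [W', hy, hW0 I ⟨y, hy⟩ hyI])

end Diffuse

/-! ### Partitions into cells of small diameter and large mass -/

section Partition

variable {X : Type*} [MeasurableSpace X]

/-- If all balls of radius `s` have mass at least `v`, the space splits into at most `1 / v`
measurable cells of diameter at most `4 s` and mass at least `v`. The cells are grown from a maximal
disjoint family of balls of radius `s`: by maximality the balls of radius `2 s` with the same
centres cover the space. -/
lemma exists_partition {μ : Measure X} [IsProbabilityMeasure μ] {D : X → X → ℝ≥0∞}
    (hD0 : ∀ x, D x x = 0) (hDs : ∀ x y, D x y = D y x) (hDt : ∀ x y z, D x z ≤ D x y + D y z)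
    (hD : ∀ y, Measurable fun x => D x y) {s v : ℝ} (hs : 0 < s) (hv : 0 < v)
    (hball : ∀ x, v ≤ μ.real {y | D x y < ENNReal.ofReal s}) :
    ∃ (N : ℕ) (Q : Fin N → Set X), (N : ℝ) * v ≤ 1 ∧ (∀ j, MeasurableSet (Q j)) ∧
      Pairwise (Function.onFun Disjoint Q) ∧ (⋃ j, Q j) = Set.univ ∧ (∀ j, v ≤ μ.real (Q j)) ∧
      ∀ j, ∀ x ∈ Q j, ∀ y ∈ Q j, D x y ≤ ENNReal.ofReal (4 * s) := by
  classical
  let B : X → Set X := fun x => {y | D x y < ENNReal.ofReal s}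
  have hBm : ∀ x, MeasurableSet (B x) := fun x => by
    have : B x = {y | D y x < ENNReal.ofReal s} := by ext y; simp [B, hDs x y]
    rw [this]
    exact hD x measurableSet_Iio
  have hBself : ∀ x, x ∈ B x := fun x => by simp [B, hD0, hs]
  -- Disjoint families of balls have at most `1 / v` members, so one of maximal size exists.
  let p : ℕ → Prop := fun N => ∃ z : Fin N → X, Pairwise (Function.onFun Disjoint fun j => B (z j))
  have hp : ∀ N, p N → (N : ℝ) * v ≤ 1 := by
    rintro N ⟨z, hz⟩
    calc (N : ℝ) * v = ∑ _j : Fin N, v := by simp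
      _ ≤ ∑ j, μ.real (B (z j)) := Finset.sum_le_sum fun j _ => hball _
      _ = μ.real (⋃ j, B (z j)) := (measureReal_iUnion_fintype hz fun j => hBm _).symm
      _ ≤ 1 := measureReal_le_one
  have hbdd : ∀ N, p N → N ≤ ⌊1 / v⌋₊ := fun N hN =>
    Nat.le_floor ((le_div_iff₀ hv).2 (hp N hN))
  have hp0 : p 0 := ⟨Fin.elim0, fun i => i.elim0⟩
  set N := Nat.findGreatest p ⌊1 / v⌋₊ with hN
  obtain ⟨z, hz⟩ : p N := Nat.findGreatest_spec (Nat.zero_le _) hp0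
  have hmax : ∀ x, ∃ j, D (z j) x < ENNReal.ofReal (2 * s) := by
    intro x
    by_contra! hx
    have hdis : ∀ j, Disjoint (B (z j)) (B x) := fun j => by
      refine Set.disjoint_left.2 fun y hy hy' => (hx j).not_gt ?_
      calc D (z j) x ≤ D (z j) y + D y x := hDt _ _ _
        _ < ENNReal.ofReal s + ENNReal.ofReal s :=
            ENNReal.add_lt_add hy (by rw [hDs]; exact hy')
        _ = ENNReal.ofReal (2 * s) := by rw [← ENNReal.ofReal_add hs.le hs.le, two_mul]
    have : p (N + 1) := by
      refine ⟨Fin.cons x z, fun i j hij => ?_⟩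
      rcases Fin.eq_zero_or_eq_succ i with rfl | ⟨i, rfl⟩ <;>
        rcases Fin.eq_zero_or_eq_succ j with rfl | ⟨j, rfl⟩
      · exact absurd rfl hij
      · simpa [Function.onFun] using (hdis j).symm
      · simpa [Function.onFun] using hdis i
      · simpa [Function.onFun] using hz fun h => hij (by rw [h])
    have h1 := Nat.le_findGreatest (hbdd _ this) this
    omega
  let R : Fin N → Set X := fun j => B (z j) ∪
    ({x | D (z j) x < ENNReal.ofReal (2 * s)} \ ⋃ i, B (z i))
  let Q : Fin N → Set X := fun j => R j \ ⋃ i, ⋃ (_ : i < j), R i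
  have hRm : ∀ j, MeasurableSet (R j) := fun j => by
    have h2 : {x | D (z j) x < ENNReal.ofReal (2 * s)} =
        {x | D x (z j) < ENNReal.ofReal (2 * s)} := by ext y; simp [hDs _ y]
    refine (hBm _).union (MeasurableSet.diff ?_ (MeasurableSet.iUnion fun i => hBm _))
    rw [h2]
    exact hD _ measurableSet_Iio
  have hQm : ∀ j, MeasurableSet (Q j) := fun j =>
    (hRm j).diff (MeasurableSet.iUnion fun i => MeasurableSet.iUnion fun _ => hRm i)
  have hBQ : ∀ j, B (z j) ⊆ Q j := fun j x hx => by
    refine ⟨.inl hx, ?_⟩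
    simp only [Set.mem_iUnion, not_exists]
    rintro i hij (hi | hi)
    · exact Set.disjoint_left.1 (hz hij.ne) hi hx
    · exact hi.2 (Set.mem_iUnion.2 ⟨j, hx⟩)
  have hQr : ∀ j, ∀ x ∈ Q j, D (z j) x ≤ ENNReal.ofReal (2 * s) := by
    rintro j x ⟨hx | hx, -⟩
    · exact (lt_of_lt_of_le hx (ENNReal.ofReal_le_ofReal (by linarith))).le
    · exact hx.1.le
  refine ⟨N, Q, hp N ⟨z, hz⟩, hQm, ?_, ?_, fun j => (hball (z j)).trans ?_, ?_⟩
  · have key : ∀ i j, i < j → Disjoint (Q i) (Q j) := fun i j hij =>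
      Set.disjoint_left.2 fun x hi hj => hj.2 (Set.mem_iUnion₂.2 ⟨i, hij, hi.1⟩)
    intro i j hij
    rcases hij.lt_or_gt with h | h
    · exact key i j h
    · exact (key j i h).symm
  · refine Set.eq_univ_of_forall fun x => ?_
    have hx : ∃ j, x ∈ R j := by
      by_cases hxB : x ∈ ⋃ i, B (z i)
      · obtain ⟨i, hi⟩ := Set.mem_iUnion.1 hxB
        exact ⟨i, .inl hi⟩
      · obtain ⟨j, hj⟩ := hmax x
        exact ⟨j, .inr ⟨hj, hxB⟩⟩
    obtain ⟨j, hj, hmin⟩ := WellFounded.has_min (wellFounded_lt (α := Fin N)) {j | x ∈ R j} hx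
    refine Set.mem_iUnion.2 ⟨j, hj, ?_⟩
    simp only [Set.mem_iUnion, not_exists]
    exact fun i hij hi => hmin i hi hij
  · exact measureReal_mono (hBQ j)
  · intro j x hx y hy
    calc D x y ≤ D x (z j) + D (z j) y := hDt _ _ _
      _ ≤ ENNReal.ofReal (2 * s) + ENNReal.ofReal (2 * s) :=
          add_le_add (by rw [hDs]; exact hQr j x hx) (hQr j y hy)
      _ = ENNReal.ofReal (4 * s) := by
          rw [← ENNReal.ofReal_add (by positivity) (by positivity)]; ring_nf

end Partition

/-! ### Relative deviations of empirical frequencies -/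

section Chernoff

variable {X Ω : Type*} [MeasurableSpace X] [MeasurableSpace Ω]

/-- The proportion of the sample points `x i` that lie in `Q`. -/
noncomputable def frequency {Z : Type*} {n : ℕ} (x : Fin n → Z) (Q : Set Z) : ℝ :=
  (n : ℝ)⁻¹ * ∑ i, Q.indicator (fun _ => (1 : ℝ)) (x i)

lemma frequency_nonneg {Z : Type*} {n : ℕ} (x : Fin n → Z) (S : Set Z) : 0 ≤ frequency x S :=
  mul_nonneg (by positivity)
    (Finset.sum_nonneg fun i _ => Set.indicator_nonneg (fun _ _ => zero_le_one) _)

lemma measurable_frequency {n : ℕ} {Y : Fin n → Ω → X} (hY : ∀ i, Measurable (Y i)) {Q : Set X}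
    (hQ : MeasurableSet Q) : Measurable fun w => frequency (fun i => Y i w) Q :=
  (Finset.measurable_sum _ fun i _ =>
    (measurable_const.indicator hQ : Measurable (Q.indicator fun _ => (1 : ℝ))).comp
      (hY i)).const_mul _

lemma mgf_indicator {P : Measure Ω} [IsProbabilityMeasure P] {Y : Ω → X} (hY : Measurable Y)
    {Q : Set X} (hQ : MeasurableSet Q) (s : ℝ) :
    mgf (fun w => Q.indicator (fun _ => (1 : ℝ)) (Y w)) P s =
      1 + (P.map Y).real Q * (Real.exp s - 1) := by
  have h1 : (fun w => Real.exp (s * Q.indicator (fun _ => (1 : ℝ)) (Y w))) =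
      fun w => 1 + (Y ⁻¹' Q).indicator (fun _ => Real.exp s - 1) w := by
    funext w
    by_cases hw : Y w ∈ Q <;> simp [hw]
  rw [mgf, h1, integral_add (integrable_const _)
    ((integrable_const _).indicator (hY hQ)), integral_indicator (hY hQ)]
  simp [map_measureReal_apply hY hQ]

lemma mgf_sum_indicator_le {P : Measure Ω} [IsProbabilityMeasure P] {μ : Measure X}
    {n : ℕ} {Y : Fin n → Ω → X} (hY : ∀ i, Measurable (Y i)) (hind : iIndepFun Y P)
    (hμ : ∀ i, P.map (Y i) = μ) {Q : Set X} (hQ : MeasurableSet Q) {s : ℝ} (hs : |s| ≤ 1) :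
    mgf (fun w => ∑ i, Q.indicator (fun _ => (1 : ℝ)) (Y i w)) P s ≤
      Real.exp (n * (μ.real Q * (s + s ^ 2))) := by
  have hm : Measurable (Q.indicator fun _ => (1 : ℝ)) := measurable_const.indicator hQ
  have hind' := hind.comp (fun _ => Q.indicator fun _ => (1 : ℝ)) fun _ => hm
  have hsum := hind'.mgf_sum (t := s) (fun i => hm.comp (hY i)) Finset.univ
  have hexp : Real.exp s - 1 ≤ s + s ^ 2 := by
    have := (abs_le.1 (Real.abs_exp_sub_one_sub_id_le hs)).2
    linarith
  calc mgf (fun w => ∑ i, Q.indicator (fun _ => (1 : ℝ)) (Y i w)) P s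
      = ∏ i : Fin n, mgf (fun w => Q.indicator (fun _ => (1 : ℝ)) (Y i w)) P s := by
        refine Eq.trans ?_ hsum
        congr 1
        ext w
        simp
    _ = ∏ _i : Fin n, (1 + μ.real Q * (Real.exp s - 1)) :=
        Finset.prod_congr rfl fun i _ => by rw [mgf_indicator (hY i) hQ, hμ i]
    _ = (1 + μ.real Q * (Real.exp s - 1)) ^ n := by simp
    _ ≤ (Real.exp (μ.real Q * (s + s ^ 2))) ^ n := by
        by_cases hpos : 0 ≤ 1 + μ.real Q * (Real.exp s - 1)
        · refine pow_le_pow_left₀ hpos ?_ n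
          have h1 := mul_le_mul_of_nonneg_left hexp (measureReal_nonneg (μ := μ) (s := Q))
          linarith [Real.add_one_le_exp (μ.real Q * (s + s ^ 2))]
        · rcases Nat.eq_zero_or_pos n with rfl | hn
          · simp
          -- The base is the moment generating function of a single indicator, hence nonnegative.
          · refine absurd ?_ hpos
            rw [← hμ ⟨0, hn⟩, ← mgf_indicator (hY ⟨0, hn⟩) hQ]
            exact mgf_nonneg
    _ = Real.exp (n * (μ.real Q * (s + s ^ 2))) := by rw [← Real.exp_nat_mul]

/-- Chernoff's bound for the relative error of an empirical frequency. -/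
lemma measure_frequency_sub_gt_le {P : Measure Ω} [IsProbabilityMeasure P] {μ : Measure X}
    {n : ℕ} (hn : 0 < n) {Y : Fin n → Ω → X} (hY : ∀ i, Measurable (Y i)) (hind : iIndepFun Y P)
    (hμ : ∀ i, P.map (Y i) = μ) {Q : Set X} (hQ : MeasurableSet Q) {τ : ℝ} (hτ : 0 ≤ τ)
    (hτ2 : τ ≤ 2) :
    P.real {w | τ * μ.real Q < |frequency (fun i => Y i w) Q - μ.real Q|} ≤
      2 * Real.exp (-(n * μ.real Q * τ ^ 2 / 4)) := by
  set p := μ.real Q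
  set S : Ω → ℝ := fun w => ∑ i, Q.indicator (fun _ => (1 : ℝ)) (Y i w) with hS
  have hn' : (0 : ℝ) < n := by exact_mod_cast hn
  have hm : Measurable (Q.indicator fun _ => (1 : ℝ)) := measurable_const.indicator hQ
  have hSm : Measurable S := Finset.measurable_sum _ fun i _ => hm.comp (hY i)
  have hSint : ∀ s, Integrable (fun w => Real.exp (s * S w)) P := fun s =>
    integrable_exp_mul_of_mem_Icc (a := 0) (b := n) hSm.aemeasurable
      (Filter.Eventually.of_forall fun w =>
        ⟨Finset.sum_nonneg fun i _ => Set.indicator_nonneg (fun _ _ => zero_le_one) _, by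
          calc S w ≤ ∑ _i : Fin n, (1 : ℝ) :=
                Finset.sum_le_sum fun i _ => Set.indicator_le_self' (by simp) _
            _ = n := by simp⟩)
  have hup : P.real {w | n * (p * (1 + τ)) ≤ S w} ≤ Real.exp (-(n * p * τ ^ 2 / 4)) := by
    refine (measure_ge_le_exp_mul_mgf _ (show 0 ≤ τ / 2 by positivity) (hSint _)).trans ?_
    refine (mul_le_mul_of_nonneg_left (mgf_sum_indicator_le hY hind hμ hQ (s := τ / 2)
      (by rw [abs_of_nonneg (by positivity)]; linarith)) (Real.exp_nonneg _)).trans ?_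
    rw [← Real.exp_add]
    exact Real.exp_le_exp.2 (le_of_eq (by ring))
  have hlow : P.real {w | S w ≤ n * (p * (1 - τ))} ≤ Real.exp (-(n * p * τ ^ 2 / 4)) := by
    refine (measure_le_le_exp_mul_mgf _ (show -(τ / 2) ≤ 0 by linarith) (hSint _)).trans ?_
    refine (mul_le_mul_of_nonneg_left (mgf_sum_indicator_le hY hind hμ hQ (s := -(τ / 2))
      (by rw [abs_neg, abs_of_nonneg (by positivity)]; linarith)) (Real.exp_nonneg _)).trans ?_
    rw [← Real.exp_add]
    exact Real.exp_le_exp.2 (le_of_eq (by ring))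
  have hsub : {w | τ * p < |frequency (fun i => Y i w) Q - p|} ⊆
      {w | n * (p * (1 + τ)) ≤ S w} ∪ {w | S w ≤ n * (p * (1 - τ))} := by
    intro w hw
    have hfS : S w = n * frequency (fun i => Y i w) Q := by
      rw [frequency, ← mul_assoc, mul_inv_cancel₀ hn'.ne', one_mul]
    simp only [Set.mem_union, Set.mem_ofPred_eq, hfS]
    rcases lt_abs.1 hw.out with h | h
    · exact .inl (mul_le_mul_of_nonneg_left (by linarith) hn'.le)
    · exact .inr (mul_le_mul_of_nonneg_left (by linarith) hn'.le)
  calc _ ≤ _ := measureReal_mono hsub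
    _ ≤ _ := measureReal_union_le _ _
    _ ≤ _ := add_le_add hup hlow
    _ = _ := by ring

/-- Prefactors of an exponential tail are absorbed by a smaller rate, except where the resulting
bound on the probability exceeds `1` anyway. -/
lemma exists_rate_absorb {a b : ℝ} (ha : 0 < a) (hb : 0 < b) :
    ∃ c > (0 : ℝ), ∀ t, 0 ≤ t →
      a * Real.exp (-(b * t)) < Real.exp (-(c * t)) ∨ 1 < 2 * Real.exp (-(c * t)) := by
  have hlog2 := Real.log_pos one_lt_two
  set L := 2 * (|Real.log a| + 1) / b with hL
  have hLpos : 0 < L := by positivity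
  refine ⟨min (b / 2) (Real.log 2 / (2 * L)), by positivity, fun t ht => ?_⟩
  have hc1 := mul_le_mul_of_nonneg_right (min_le_left (b / 2) (Real.log 2 / (2 * L))) ht
  have hc2 := mul_le_mul_of_nonneg_right (min_le_right (b / 2) (Real.log 2 / (2 * L))) ht
  rcases le_or_gt L t with h | h
  · left
    have h1 : 2 * (|Real.log a| + 1) ≤ b * t := by
      rw [hL, div_le_iff₀ hb] at h; linarith
    have h2 := le_abs_self (Real.log a)
    nth_rewrite 1 [← Real.exp_log ha]
    rw [← Real.exp_add]
    exact Real.exp_lt_exp.2 (by linarith)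
  · right
    have h1 : Real.log 2 / (2 * L) * t < Real.log 2 := by
      rw [div_mul_eq_mul_div, div_lt_iff₀ (by positivity)]
      nlinarith
    nth_rewrite 1 [← Real.exp_log two_pos]
    rw [← Real.exp_add, ← Real.exp_zero]
    exact Real.exp_lt_exp.2 (by linarith)

end Chernoff

/-! ### Geodesic distance and volume in charts -/

section Geometry

variable {m d : ℕ} {M : Type*} [TopologicalSpace M] [ChartedSpace (EuclideanSpace ℝ (Fin m)) M]

/-- The length of tangent vectors of `M` measured through the embedding `ι`, as in the definition of
`geodesicEDist`. -/
@[reducible]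
noncomputable def inducedENorm (ι : M → EuclideanSpace ℝ (Fin d)) (p : M) :
    ENorm (TangentSpace (𝓡 m) p) :=
  ⟨fun v => enorm (E := EuclideanSpace ℝ (Fin d)) (mfderiv (𝓡 m) (𝓡 d) ι p v)⟩

lemma enormSMulClass_inducedENorm (ι : M → EuclideanSpace ℝ (Fin d)) (p : M) :
    letI := inducedENorm (m := m) ι p
    ENormSMulClass ℝ (TangentSpace (𝓡 m) p) :=
  letI := inducedENorm (m := m) ι p
  ⟨fun r v => (congrArg (enorm (E := EuclideanSpace ℝ (Fin d)))
    (map_smul (mfderiv (𝓡 m) (𝓡 d) ι p) r v)).trans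
      (enorm_smul (β := EuclideanSpace ℝ (Fin d)) r _)⟩

lemma geodesicEDist_self (ι : M → EuclideanSpace ℝ (Fin d)) (x : M) :
    geodesicEDist (m := m) ι x x = 0 := by
  let : ∀ p : M, ENorm (TangentSpace (𝓡 m) p) := inducedENorm ι
  have := enormSMulClass_inducedENorm (m := m) ι
  exact riemannianEDist_self

lemma geodesicEDist_comm (ι : M → EuclideanSpace ℝ (Fin d)) (x y : M) :
    geodesicEDist (m := m) ι x y = geodesicEDist (m := m) ι y x := by
  let : ∀ p : M, ENorm (TangentSpace (𝓡 m) p) := inducedENorm ι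
  have := enormSMulClass_inducedENorm (m := m) ι
  exact riemannianEDist_comm

lemma geodesicEDist_triangle (ι : M → EuclideanSpace ℝ (Fin d)) (x y z : M) :
    geodesicEDist (m := m) ι x z ≤ geodesicEDist (m := m) ι x y + geodesicEDist (m := m) ι y z := by
  let : ∀ p : M, ENorm (TangentSpace (𝓡 m) p) := inducedENorm ι
  have := enormSMulClass_inducedENorm (m := m) ι
  exact riemannianEDist_triangle

lemma geodesicEDist_le_pathELength {ι : M → EuclideanSpace ℝ (Fin d)}
    (hι : ContMDiff (𝓡 m) (𝓡 d) ∞ ι) {γ : ℝ → M} {U : Set ℝ} (hU : IsOpen U)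
    (hUI : Set.Icc 0 1 ⊆ U) (hγ : ContMDiffOn 𝓘(ℝ, ℝ) (𝓡 m) 1 γ U) :
    geodesicEDist (m := m) ι (γ 0) (γ 1) ≤ ∫⁻ t in Set.Icc (0 : ℝ) 1, ‖deriv (ι ∘ γ) t‖ₑ := by
  let : ∀ p : M, ENorm (TangentSpace (𝓡 m) p) := inducedENorm ι
  have := enormSMulClass_inducedENorm (m := m) ι
  refine (riemannianEDist_le_pathELength (hγ.mono hUI) rfl rfl zero_le_one).trans_eq ?_
  rw [pathELength_eq_lintegral_mfderiv_Icc]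
  refine setLIntegral_congr_fun measurableSet_Icc fun t ht => ?_
  have h1 : MDifferentiableAt (𝓡 m) (𝓡 d) ι (γ t) := (hι (γ t)).mdifferentiableAt (by simp)
  have h2 : MDifferentiableAt 𝓘(ℝ, ℝ) (𝓡 m) γ t :=
    (hγ.contMDiffAt (hU.mem_nhds (hUI ht))).mdifferentiableAt (by simp)
  change enorm (E := EuclideanSpace ℝ (Fin d))
    (mfderiv (𝓡 m) (𝓡 d) ι (γ t) (mfderiv 𝓘(ℝ, ℝ) (𝓡 m) γ t 1)) = _
  have h3 := mfderiv_comp t h1 h2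
  have h4 : mfderiv 𝓘(ℝ, ℝ) (𝓡 d) (ι ∘ γ) t = fderiv ℝ (ι ∘ γ) t := mfderiv_eq_fderiv
  rw [h4] at h3
  rw [← fderiv_apply_one_eq_deriv, h3]
  rfl

/-- In a chart `e` near `x₀` on whose target the embedding read through `e` is `L`-Lipschitz on a
ball, the geodesic distance is at most `L` times the Euclidean distance of the coordinates: the
segment between the coordinates is a competitor. -/
lemma geodesicEDist_symm_le {ι : M → EuclideanSpace ℝ (Fin d)}
    (hι : ContMDiff (𝓡 m) (𝓡 d) ∞ ι) {e : OpenPartialHomeomorph M (EuclideanSpace ℝ (Fin m))}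
    (he : ContMDiffOn (𝓡 m) (𝓡 m) ∞ e.symm e.target) {z : EuclideanSpace ℝ (Fin m)} {R : ℝ}
    (hR : Metric.ball z R ⊆ e.target) {L : ℝ≥0}
    (hL : LipschitzOnWith L (ι ∘ e.symm) (Metric.ball z R)) {u v : EuclideanSpace ℝ (Fin m)}
    (hu : u ∈ Metric.ball z R) (hv : v ∈ Metric.ball z R) :
    geodesicEDist (m := m) ι (e.symm u) (e.symm v) ≤ L * edist u v := by
  let l : ℝ → EuclideanSpace ℝ (Fin m) := fun t => u + t • (v - u)
  have hl : ContDiff ℝ ∞ l := by fun_prop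
  set U := l ⁻¹' Metric.ball z R
  have hU : IsOpen U := Metric.isOpen_ball.preimage hl.continuous
  have hUI : Set.Icc 0 1 ⊆ U := fun t ht =>
    (convex_ball z R).add_smul_sub_mem hu hv ht
  have hγ : ContMDiffOn 𝓘(ℝ, ℝ) (𝓡 m) 1 (e.symm ∘ l) U :=
    (he.of_le (by simp)).comp (hl.of_le (by simp)).contMDiff.contMDiffOn fun t ht => hR ht
  have hmain := geodesicEDist_le_pathELength hι hU hUI hγ
  have hlip : LipschitzOnWith (L * nndist u v) (ι ∘ e.symm ∘ l) U := by
    have h1 : LipschitzWith (nndist u v) l := LipschitzWith.of_dist_le_mul fun s t => by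
      simp only [l, dist_eq_norm, add_sub_add_left_eq_sub, ← sub_smul, norm_smul, coe_nndist]
      rw [norm_sub_rev v u, mul_comm]
    exact hL.comp h1.lipschitzOnWith fun t ht => ht
  calc geodesicEDist (m := m) ι (e.symm u) (e.symm v)
      = geodesicEDist (m := m) ι ((e.symm ∘ l) 0) ((e.symm ∘ l) 1) := by simp [l]
    _ ≤ ∫⁻ t in Set.Icc (0 : ℝ) 1, ‖deriv (ι ∘ e.symm ∘ l) t‖ₑ := hmain
    _ ≤ ∫⁻ _ in Set.Icc (0 : ℝ) 1, ((L * nndist u v : ℝ≥0) : ℝ≥0∞) := by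
        refine setLIntegral_mono measurable_const fun t ht => ?_
        rw [enorm_le_coe]
        exact norm_deriv_le_of_lipschitzOn (hU.mem_nhds (hUI ht)) hlip
    _ = L * edist u v := by rw [edist_nndist]; simp

/-- Near each point an embedded manifold has a chart that is the restriction of a Lipschitz map of
the ambient space. -/
lemma exists_chart_lipschitz [IsManifold (𝓡 m) ∞ M] {ι : M → EuclideanSpace ℝ (Fin d)}
    (hι : IsSmoothEmbedding (𝓡 m) (𝓡 d) ∞ ι) (x₀ : M) :
    ∃ e : OpenPartialHomeomorph M (EuclideanSpace ℝ (Fin m)), x₀ ∈ e.source ∧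
      ContMDiffOn (𝓡 m) (𝓡 m) ∞ e.symm e.target ∧
      ∃ (g : EuclideanSpace ℝ (Fin d) → EuclideanSpace ℝ (Fin m)) (K : ℝ≥0)
        (V : Set (EuclideanSpace ℝ (Fin d))), V ∈ 𝓝 (ι x₀) ∧ LipschitzOnWith K g V ∧
          ∀ x ∈ e.source, g (ι x) = e x := by
  have h := hι.isImmersion.isImmersionAt x₀
  have hψ : ContMDiffAt (𝓡 d) (𝓡 d) ∞ h.codChart (ι x₀) :=
    contMDiffAt_of_mem_maximalAtlas h.codChart_mem_maximalAtlas h.mem_codChart_source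
  have hψ' : ContDiffAt ℝ 1 h.codChart (ι x₀) := (hψ.contDiffAt).of_le (by simp)
  obtain ⟨K, V, hV, hK⟩ := hψ'.exists_lipschitzOnWith
  let A : EuclideanSpace ℝ (Fin d) →L[ℝ] EuclideanSpace ℝ (Fin m) :=
    (ContinuousLinearMap.fst ℝ _ h.complement).comp (h.equiv.symm : _ →L[ℝ] _)
  refine ⟨h.domChart, h.mem_domChart_source,
    contMDiffOn_symm_of_mem_maximalAtlas h.domChart_mem_maximalAtlas, A ∘ h.codChart,
    ‖A‖₊ * K, V, hV, A.lipschitz.lipschitzOnWith.comp hK (Set.mapsTo_univ _ _), fun x hx => ?_⟩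
  have hmem : h.domChart x ∈ (h.domChart.extend (𝓡 m)).target := by
    rw [OpenPartialHomeomorph.extend_target]
    simpa using h.domChart.map_source hx
  have h1 := h.writtenInCharts hmem
  simp only [Function.comp_apply, OpenPartialHomeomorph.extend_coe,
    OpenPartialHomeomorph.extend_coe_symm, modelWithCornersSelf_coe, id,
    modelWithCornersSelf_coe_symm, h.domChart.left_inv hx] at h1
  simp [A, h1]

/-- Near each point there is a chart in which the geodesic distance is at most a multiple of the
Euclidean distance, and which is the restriction of a Lipschitz map of the ambient space. -/
lemma exists_chart_bounds [IsManifold (𝓡 m) ∞ M] {ι : M → EuclideanSpace ℝ (Fin d)}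
    (hι : IsSmoothEmbedding (𝓡 m) (𝓡 d) ∞ ι) (x₀ : M) :
    ∃ e : OpenPartialHomeomorph M (EuclideanSpace ℝ (Fin m)), x₀ ∈ e.source ∧
      ∃ R > 0, Metric.ball (e x₀) R ⊆ e.target ∧ ∃ L K : ℝ≥0,
        (∀ u ∈ Metric.ball (e x₀) R, ∀ v ∈ Metric.ball (e x₀) R,
          geodesicEDist (m := m) ι (e.symm u) (e.symm v) ≤ L * edist u v) ∧
        ∃ g : EuclideanSpace ℝ (Fin d) → EuclideanSpace ℝ (Fin m),
          LipschitzOnWith K g (ι ∘ e.symm '' Metric.ball (e x₀) R) ∧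
          ∀ x ∈ e.source, g (ι x) = e x := by
  obtain ⟨e, hx₀, he, g, K, V, hV, hK, hg⟩ := exists_chart_lipschitz hι x₀
  have htarget : e.target ∈ 𝓝 (e x₀) := e.open_target.mem_nhds (e.map_source hx₀)
  have hsm : ContDiffAt ℝ 1 (ι ∘ e.symm) (e x₀) := by
    have h1 : ContMDiffOn (𝓡 m) (𝓡 d) ∞ (ι ∘ e.symm) e.target :=
      hι.contMDiff.comp_contMDiffOn he
    exact (h1.contMDiffAt htarget).contDiffAt.of_le (by simp)
  obtain ⟨L, W, hW, hL⟩ := hsm.exists_lipschitzOnWith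
  have hV' : (ι ∘ e.symm) ⁻¹' V ∈ 𝓝 (e x₀) :=
    hsm.continuousAt.preimage_mem_nhds (by simpa [e.left_inv hx₀] using hV)
  obtain ⟨R, hR, hball⟩ := Metric.mem_nhds_iff.1
    (Filter.inter_mem (Filter.inter_mem htarget hW) hV')
  have hRt : Metric.ball (e x₀) R ⊆ e.target := fun u hu => (hball hu).1.1
  refine ⟨e, hx₀, R, hR, hRt, L, K, fun u hu v hv => ?_, g, hK.mono ?_, hg⟩
  · exact geodesicEDist_symm_le hι.contMDiff he hRt (hL.mono fun u hu => (hball hu).1.2) hu hv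
  · exact Set.image_subset_iff.2 fun u hu => (hball hu).2

lemma eventually_geodesicEDist_lt [IsManifold (𝓡 m) ∞ M] {ι : M → EuclideanSpace ℝ (Fin d)}
    (hι : IsSmoothEmbedding (𝓡 m) (𝓡 d) ∞ ι) (x₀ : M) {ε : ℝ≥0∞} (hε : 0 < ε) :
    ∀ᶠ x in 𝓝 x₀, geodesicEDist (m := m) ι x x₀ < ε := by
  obtain ⟨e, hx₀, R, hR, -, L, -, hD, -⟩ := exists_chart_bounds hι x₀
  have hcont : Filter.Tendsto e (𝓝 x₀) (𝓝 (e x₀)) := e.continuousAt hx₀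
  have hlim : Filter.Tendsto (fun x => (L : ℝ≥0∞) * edist (e x) (e x₀)) (𝓝 x₀) (𝓝 0) := by
    have h1 : Filter.Tendsto (fun x => edist (e x) (e x₀)) (𝓝 x₀) (𝓝 0) :=
      tendsto_iff_edist_tendsto_0.1 hcont
    simpa using ENNReal.Tendsto.const_mul h1 (.inr ENNReal.coe_ne_top)
  filter_upwards [hlim.eventually_lt_const hε, e.open_source.mem_nhds hx₀,
    hcont.eventually (Metric.ball_mem_nhds _ hR)] with x hx hxs hxR
  have := hD (e x) hxR (e x₀) (Metric.mem_ball_self hR)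
  rw [e.left_inv hxs, e.left_inv hx₀] at this
  exact this.trans_lt hx

lemma measurable_geodesicEDist [IsManifold (𝓡 m) ∞ M] [MeasurableSpace M] [BorelSpace M]
    {ι : M → EuclideanSpace ℝ (Fin d)} (hι : IsSmoothEmbedding (𝓡 m) (𝓡 d) ∞ ι) (y : M) :
    Measurable fun x => geodesicEDist (m := m) ι x y := by
  refine measurable_of_Iio fun r => IsOpen.measurableSet (isOpen_iff_mem_nhds.2 fun x₀ hx₀ => ?_)
  have hx₀' : geodesicEDist (m := m) ι x₀ y < r := hx₀
  filter_upwards [eventually_geodesicEDist_lt hι x₀ (tsub_pos_of_lt hx₀')] with x hx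
  calc geodesicEDist (m := m) ι x y
      ≤ geodesicEDist (m := m) ι x x₀ + geodesicEDist (m := m) ι x₀ y :=
        geodesicEDist_triangle ι _ _ _
    _ < r := lt_tsub_iff_right.1 hx

lemma volume_le_euclideanHausdorffMeasure {K : ℝ≥0}
    {g : EuclideanSpace ℝ (Fin d) → EuclideanSpace ℝ (Fin m)} {S : Set (EuclideanSpace ℝ (Fin d))}
    (hg : LipschitzOnWith K g S) :
    volume (g '' S) ≤ (K : ℝ≥0∞) ^ m * (μHE[m] : Measure (EuclideanSpace ℝ (Fin d))) S := by
  rw [← EuclideanSpace.euclideanHausdorffMeasure_eq_volume,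
    Measure.euclideanHausdorffMeasure_def, Measure.euclideanHausdorffMeasure_def,
    Measure.smul_apply, Measure.smul_apply, mul_smul_comm]
  refine smul_le_smul_of_nonneg_left ?_ zero_le
  have := hg.hausdorffMeasure_image_le (d := m) (by positivity)
  rwa [ENNReal.rpow_natCast] at this

/-- Small geodesic balls around points near `x₀` have volume at least a multiple of `s ^ m`: the
geodesic ball contains the image of a coordinate ball of comparable radius, whose volume is compared
with that of the coordinate ball because the chart is Lipschitz. -/
lemma exists_volM_ball_ge_nhds [IsManifold (𝓡 m) ∞ M] [CompactSpace M] [MeasurableSpace M]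
    [BorelSpace M] {ι : M → EuclideanSpace ℝ (Fin d)}
    (hι : IsSmoothEmbedding (𝓡 m) (𝓡 d) ∞ ι) (x₀ : M) :
    ∃ U ∈ 𝓝 x₀, ∃ c > (0 : ℝ), ∃ r > (0 : ℝ), ∀ x ∈ U, ∀ s, 0 < s → s ≤ r →
      ENNReal.ofReal (c * s ^ m) ≤
        volM m ι {y | geodesicEDist (m := m) ι x y < ENNReal.ofReal s} := by
  have hemb :=
    (hι.isEmbedding.continuous.isClosedEmbedding hι.isEmbedding.injective).measurableEmbedding
  obtain ⟨e, hx₀, R, hR, hRt, L, K, hD, g, hg, hge⟩ := exists_chart_bounds hι x₀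
  have hU : e.source ∩ e ⁻¹' Metric.ball (e x₀) (R / 2) ∈ 𝓝 x₀ :=
    Filter.inter_mem (e.open_source.mem_nhds hx₀)
      ((e.continuousAt hx₀).preimage_mem_nhds (Metric.ball_mem_nhds _ (half_pos hR)))
  set b := (volume (Metric.ball (0 : EuclideanSpace ℝ (Fin m)) 1)).toReal
  have hb : 0 < b := ENNReal.toReal_pos (Metric.measure_ball_pos _ _ one_pos).ne'
    measure_ball_lt_top.ne
  have hL : (0 : ℝ) < L + 1 := by positivity
  have hK : (0 : ℝ) < K + 1 := by positivity
  refine ⟨_, hU, b / ((L + 1) ^ m * (K + 1) ^ m), by positivity, R / 2 * (L + 1), by positivity,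
    fun x hx s hs hsr => ?_⟩
  set t := s / (L + 1) with ht
  have ht0 : 0 < t := by positivity
  have htR : t ≤ R / 2 := (div_le_iff₀ hL).2 hsr
  have hsub : Metric.ball (e x) t ⊆ Metric.ball (e x₀) R :=
    Metric.ball_subset_ball' (by have := Metric.mem_ball.1 hx.2; linarith)
  have hxR : e x ∈ Metric.ball (e x₀) R := hsub (Metric.mem_ball_self ht0)
  set S := e.symm '' Metric.ball (e x) t with hS
  have hSD : S ⊆ {y | geodesicEDist (m := m) ι x y < ENNReal.ofReal s} := by
    rintro _ ⟨v, hv, rfl⟩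
    have h1 := hD (e x) hxR v (hsub hv)
    rw [e.left_inv hx.1] at h1
    refine h1.trans_lt ?_
    rw [edist_dist, ← ENNReal.ofReal_coe_nnreal, ← ENNReal.ofReal_mul L.coe_nonneg]
    refine (ENNReal.ofReal_lt_ofReal_iff hs).2 ?_
    have h2 : dist (e x) v < t := by rw [dist_comm]; exact hv
    calc (L : ℝ) * dist (e x) v ≤ (L + 1) * dist (e x) v := by gcongr; linarith
      _ < (L + 1) * t := by gcongr
      _ = s := mul_div_cancel₀ _ hL.ne'
  have himg : g '' (ι '' S) = Metric.ball (e x) t := by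
    rw [hS, Set.image_image, Set.image_image]
    refine (Set.image_congr fun v hv => ?_).trans (Set.image_id _)
    rw [hge _ (e.map_target (hRt (hsub hv))), e.right_inv (hRt (hsub hv)), id]
  have hLip : LipschitzOnWith K g (ι '' S) := hg.mono (by
    rw [hS, ← Set.image_comp]
    exact Set.image_mono hsub)
  have hvol := volume_le_euclideanHausdorffMeasure hLip
  rw [himg, Measure.addHaar_ball_of_pos _ _ ht0, finrank_euclideanSpace_fin,
    ← ENNReal.ofReal_toReal (measure_ball_lt_top (μ := volume)
      (x := (0 : EuclideanSpace ℝ (Fin m))) (r := 1)).ne, ← ENNReal.ofReal_mul (by positivity)]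
    at hvol
  refine le_trans ?_ (measure_mono hSD)
  rw [volM, hemb.comap_apply]
  have hKm : ENNReal.ofReal (((K : ℝ) + 1) ^ m) ≠ 0 := by
    rw [ne_eq, ENNReal.ofReal_eq_zero, not_le]; positivity
  rw [← ENNReal.mul_le_mul_iff_right hKm ENNReal.ofReal_ne_top,
    ← ENNReal.ofReal_mul (by positivity)]
  calc ENNReal.ofReal (((K : ℝ) + 1) ^ m * (b / ((L + 1) ^ m * (K + 1) ^ m) * s ^ m))
      = ENNReal.ofReal (t ^ m * b) := by
        congr 1
        rw [ht, div_pow]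
        field_simp
    _ ≤ (K : ℝ≥0∞) ^ m * (μHE[m] : Measure (EuclideanSpace ℝ (Fin d))) (ι '' S) := hvol
    _ ≤ _ := by
        gcongr
        rw [ENNReal.ofReal_pow hK.le]
        gcongr
        rw [← ENNReal.ofReal_coe_nnreal]
        exact ENNReal.ofReal_le_ofReal (by linarith)

lemma exists_volM_ball_ge [IsManifold (𝓡 m) ∞ M] [CompactSpace M] [MeasurableSpace M]
    [BorelSpace M] {ι : M → EuclideanSpace ℝ (Fin d)}
    (hι : IsSmoothEmbedding (𝓡 m) (𝓡 d) ∞ ι) :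
    ∃ c > (0 : ℝ), ∃ r > (0 : ℝ), ∀ x, ∀ s, 0 < s → s ≤ r →
      ENNReal.ofReal (c * s ^ m) ≤
        volM m ι {y | geodesicEDist (m := m) ι x y < ENNReal.ofReal s} := by
  let p : Set M → Prop := fun U => ∃ c > (0 : ℝ), ∃ r > (0 : ℝ), ∀ x ∈ U, ∀ s, 0 < s → s ≤ r →
      ENNReal.ofReal (c * s ^ m) ≤
        volM m ι {y | geodesicEDist (m := m) ι x y < ENNReal.ofReal s}
  have huniv : p Set.univ := by
    refine isCompact_univ.induction_on (p := p) ⟨1, one_pos, 1, one_pos, by simp⟩ ?_ ?_ ?_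
    · rintro U V hUV ⟨c, hc, r, hr, h⟩
      exact ⟨c, hc, r, hr, fun x hx => h x (hUV hx)⟩
    · rintro U V ⟨c, hc, r, hr, h⟩ ⟨c', hc', r', hr', h'⟩
      refine ⟨min c c', lt_min hc hc', min r r', lt_min hr hr', fun x hx s hs hsr => ?_⟩
      have hsm : 0 ≤ s ^ m := by positivity
      rcases hx with hx | hx
      · exact (ENNReal.ofReal_le_ofReal (mul_le_mul_of_nonneg_right (min_le_left _ _) hsm)).trans
          (h x hx s hs (hsr.trans (min_le_left _ _)))
      · exact (ENNReal.ofReal_le_ofReal (mul_le_mul_of_nonneg_right (min_le_right _ _) hsm)).trans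
          (h' x hx s hs (hsr.trans (min_le_right _ _)))
    · intro x _
      obtain ⟨U, hU, h⟩ := exists_volM_ball_ge_nhds hι x
      exact ⟨U, mem_nhdsWithin_of_mem_nhds hU, h⟩
  obtain ⟨c, hc, r, hr, h⟩ := huniv
  exact ⟨c, hc, r, hr, fun x => h x (Set.mem_univ x)⟩

/-- In positive dimension points are null sets of the Riemannian volume; a measurable embedding of
the ambient space into `ℝ` turns this into diffuseness. -/
lemma isDiffuse_volM (hm : 1 ≤ m) [CompactSpace M] [MeasurableSpace M]
    [BorelSpace M] {ι : M → EuclideanSpace ℝ (Fin d)}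
    (hι : IsSmoothEmbedding (𝓡 m) (𝓡 d) ∞ ι) : IsDiffuse (volM m ι) := by
  have hemb :=
    (hι.isEmbedding.continuous.isClosedEmbedding hι.isEmbedding.injective).measurableEmbedding
  have hreal := measurableEmbedding_embeddingReal (EuclideanSpace ℝ (Fin d))
  refine ⟨embeddingReal (EuclideanSpace ℝ (Fin d)) ∘ ι, hreal.measurable.comp hemb.measurable,
    fun t => ?_⟩
  rw [volM, hemb.comap_apply]
  have := Measure.nullSingletonClass_hausdorff (EuclideanSpace ℝ (Fin d)) (d := m) (by positivity)
  have hsub : (ι '' (embeddingReal (EuclideanSpace ℝ (Fin d)) ∘ ι ⁻¹' {t})).Subsingleton := by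
    rintro _ ⟨x, hx, rfl⟩ _ ⟨y, hy, rfl⟩
    exact hreal.injective (Eq.trans hx (Eq.symm hy))
  rw [Measure.euclideanHausdorffMeasure_def, Measure.smul_apply, hsub.measure_zero, smul_zero]

/-- Functions of class `C^{2,α}` are measurable, being continuous. -/
lemma IsC2Holder.measurable [MeasurableSpace M] [BorelSpace M] {α : ℝ≥0} {f : M → ℝ}
    (hf : IsC2Holder m α f) : Measurable f := by
  refine (continuous_iff_continuousAt.2 fun x => ?_).measurable
  obtain ⟨W, hW, hxW, -, hd, -⟩ := hf x
  have h1 : ContinuousAt (f ∘ (extChartAt (𝓡 m) x).symm) (extChartAt (𝓡 m) x x) :=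
    hd.continuousOn.continuousAt (hW.mem_nhds hxW)
  have h2 := h1.comp (continuousAt_extChartAt (I := 𝓡 m) x)
  refine h2.congr ?_
  filter_upwards [extChartAt_source_mem_nhds (I := 𝓡 m) x] with y hy
  exact congrArg f ((extChartAt (𝓡 m) x).left_inv hy)

end Geometry

/-! ### Rescaling the density cell by cell -/

section Rescaling

variable {X : Type*} [MeasurableSpace X]

/-- Two measures that agree on the cells of a partition into sets of diameter at most `δ`, the first
diffuse and the second finitely supported, have a bottleneck-optimal transport map, and it moves no
point by more than `δ`. -/
lemma IsDiffuse.exists_isLeast_displacement_le [MeasurableSingletonClass X] {μ ν : Measure X}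
    [IsFiniteMeasure μ] (h : IsDiffuse μ) {Y : Finset X} (hY : ν (Y : Set X)ᶜ = 0)
    {D : X → X → ℝ≥0∞} (hD0 : ∀ x, D x x = 0) (hD : ∀ y, Measurable fun x => D x y)
    {κ : Type*} [Fintype κ] {Q : κ → Set X} (hQ : ∀ j, MeasurableSet (Q j))
    (hQd : Pairwise (Function.onFun Disjoint Q)) (hQu : (⋃ j, Q j) = Set.univ)
    (hμν : ∀ j, μ (Q j) = ν (Q j)) {δ : ℝ≥0∞} (hδ : ∀ j, ∀ x ∈ Q j, ∀ y ∈ Q j, D x y ≤ δ) :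
    ∃ r, IsLeast ((fun T : X → X => ⨆ x, D x (T x)) '' {T | IsTransportMap μ ν T}) r ∧ r ≤ δ := by
  have hmass : μ Set.univ = ν Set.univ := by
    rw [← hQu, measure_iUnion hQd hQ, measure_iUnion hQd hQ]
    simp [hμν]
  have hrow : ∀ j, ∑ y ∈ Y, ν ({y} ∩ Q j) = μ (Q j) := fun j => by
    rw [hμν, ← measure_biUnion_finset
      (fun y _ y' _ hne => (Set.disjoint_singleton.2 hne).mono Set.inter_subset_left
        Set.inter_subset_left) fun y _ => (measurableSet_singleton y).inter (hQ j)]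
    have h1 : ⋃ y ∈ Y, {y} ∩ Q j = Q j ∩ Y := by ext x; simp [and_comm]
    have h2 : ν (Q j \ Y) = 0 := measure_mono_null (fun x hx => hx.2) hY
    rw [h1, ← measure_inter_add_sdiff (Q j) Y.measurableSet, h2, add_zero]
  have hcol : ∀ y ∈ Y, ∑ j, ν ({y} ∩ Q j) = ν {y} := fun y _ => by
    rw [← measure_biUnion_finset
      (fun i _ j _ hne => (hQd hne).mono Set.inter_subset_right Set.inter_subset_right)
      fun j _ => (measurableSet_singleton y).inter (hQ j)]
    simp [← Set.inter_iUnion, hQu]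
  obtain ⟨T, hT, hTx⟩ := h.exists_transport_of_plan hmass hY hQ hQd _ hrow hcol
  obtain ⟨r, hr⟩ := h.exists_isLeast_displacement hY hD0 hD ⟨T, hT⟩
  refine ⟨r, hr, (hr.2 ⟨T, hT, rfl⟩).trans (iSup_le fun x => ?_)⟩
  rcases hTx x with hx | ⟨j, y, -, hxj, hx, hne⟩
  · simp [hx, hD0]
  · rw [hx]
    refine hδ j x hxj y ?_
    by_contra hy
    exact hne (by rw [Set.singleton_inter_eq_empty.2 hy, measure_empty])

lemma empiricalMeasure_apply {n : ℕ} (hn : 0 < n) (x : Fin n → X) {S : Set X}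
    (hS : MeasurableSet S) : empiricalMeasure x S = ENNReal.ofReal (frequency x S) := by
  have h1 : ∀ i, Measure.dirac (x i) S = ENNReal.ofReal (S.indicator (fun _ => (1 : ℝ)) (x i)) :=
    fun i => by
      rw [Measure.dirac_apply' _ hS]
      by_cases hi : x i ∈ S <;> simp [hi]
  rw [empiricalMeasure, frequency, Measure.smul_apply, Measure.finsetSum_apply,
    ENNReal.ofReal_mul (by positivity), ENNReal.ofReal_inv_of_pos (by positivity),
    ENNReal.ofReal_natCast,
    ENNReal.ofReal_sum_of_nonneg fun i _ => Set.indicator_nonneg (fun _ _ => zero_le_one) _]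
  simp [h1]

/-- If the empirical frequencies of the cells of a partition into sets of diameter at most `δ`
have relative error at most `τ`, then multiplying `ρ` on each cell by the ratio of frequency and
probability gives a density close to `ρ` whose measure gives each cell its empirical mass. -/
lemma exists_density_of_partition {m d : ℕ} {M : Type*} [MeasurableSpace M]
    [MeasurableSingletonClass M] {ι : M → EuclideanSpace ℝ (Fin d)} (hvol : IsDiffuse (volM m ι))
    {D : M → M → ℝ≥0∞} (hD0 : ∀ x, D x x = 0) (hD : ∀ y, Measurable fun x => D x y)
    {ρ : M → ℝ} (hρm : Measurable ρ) (hρ0 : ∀ x, 0 ≤ ρ x) {ρmax : ℝ} (hρmax : ∀ x, ρ x ≤ ρmax)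
    [IsProbabilityMeasure (densityMeasure m ι ρ)] {κ : Type*} [Fintype κ] {Q : κ → Set M}
    (hQ : ∀ j, MeasurableSet (Q j)) (hQd : Pairwise (Function.onFun Disjoint Q))
    (hQu : (⋃ j, Q j) = Set.univ) (hQpos : ∀ j, 0 < (densityMeasure m ι ρ).real (Q j))
    {δ : ℝ≥0∞} (hδ : ∀ j, ∀ x ∈ Q j, ∀ y ∈ Q j, D x y ≤ δ) {n : ℕ} (hn : 0 < n) (x : Fin n → M)
    {τ : ℝ} (hτ : ∀ j, |frequency x (Q j) - (densityMeasure m ι ρ).real (Q j)| ≤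
      τ * (densityMeasure m ι ρ).real (Q j)) :
    ∃ ρ' : M → ℝ, Measurable ρ' ∧ (∀ z, 0 ≤ ρ' z) ∧
      IsProbabilityMeasure (densityMeasure m ι ρ') ∧
      (∃ r, IsLeast ((fun T : M → M => ⨆ z, D z (T z)) ''
        {T | IsTransportMap (densityMeasure m ι ρ') (empiricalMeasure x) T}) r ∧ r ≤ δ) ∧
      ∀ z, |ρ z - ρ' z| ≤ ρmax * τ := by
  classical
  set p : κ → ℝ := fun j => (densityMeasure m ι ρ).real (Q j)
  set q : κ → ℝ := fun j => frequency x (Q j)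
  let ρ' : M → ℝ := fun z => ∑ j, (Q j).indicator (fun z => ρ z * (q j / p j)) z
  have hρ'Q : ∀ j, ∀ z ∈ Q j, ρ' z = ρ z * (q j / p j) := fun j z hz => by
    refine (Finset.sum_eq_single j (fun i _ hij => ?_) (by simp)).trans (by simp [hz])
    exact Set.indicator_of_notMem (fun hi => Set.disjoint_left.1 (hQd hij) hi hz) _
  have hcell : ∀ z, ∃ j, z ∈ Q j := fun z => Set.mem_iUnion.1 (hQu ▸ Set.mem_univ z)
  have hratio : ∀ j, 0 ≤ q j / p j := fun j => div_nonneg (frequency_nonneg _ _) (hQpos j).le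
  have hρ'm : Measurable ρ' :=
    Finset.measurable_sum _ fun j _ => (hρm.mul_const _).indicator (hQ j)
  have hρ'Qμ : ∀ j, densityMeasure m ι ρ' (Q j) = empiricalMeasure x (Q j) := fun j => by
    have h1 : densityMeasure m ι ρ (Q j) = ENNReal.ofReal (p j) := by
      rw [ofReal_measureReal]
    rw [empiricalMeasure_apply hn x (hQ j), densityMeasure, withDensity_apply _ (hQ j)]
    rw [densityMeasure, withDensity_apply _ (hQ j)] at h1
    calc ∫⁻ z in Q j, ENNReal.ofReal (ρ' z) ∂volM m ι
        = ∫⁻ z in Q j, ENNReal.ofReal (ρ z) * ENNReal.ofReal (q j / p j) ∂volM m ι :=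
          setLIntegral_congr_fun (hQ j) fun z hz => by
            rw [hρ'Q j z hz, ENNReal.ofReal_mul (hρ0 z)]
      _ = ENNReal.ofReal (p j) * ENNReal.ofReal (q j / p j) := by
          rw [lintegral_mul_const _ hρm.ennreal_ofReal, h1]
      _ = ENNReal.ofReal (q j) := by
          rw [← ENNReal.ofReal_mul (hQpos j).le, mul_div_cancel₀ _ (hQpos j).ne']
  have hprob : IsProbabilityMeasure (densityMeasure m ι ρ') := ⟨by
    have h1 : empiricalMeasure x Set.univ = 1 := by
      rw [empiricalMeasure_apply hn x .univ]
      simp [frequency, hn.ne']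
    rw [← h1, ← hQu, measure_iUnion hQd hQ, measure_iUnion hQd hQ]
    simp only [hρ'Qμ]⟩
  refine ⟨ρ', hρ'm, fun z => ?_, hprob, ?_, fun z => ?_⟩
  · obtain ⟨j, hj⟩ := hcell z
    rw [hρ'Q j z hj]
    exact mul_nonneg (hρ0 z) (hratio j)
  · have hdiff : IsDiffuse (densityMeasure m ι ρ') :=
      hvol.mono (withDensity_absolutelyContinuous _ _)
    refine hdiff.exists_isLeast_displacement_le (Y := Finset.univ.image x) ?_ hD0 hD hQ hQd hQu
      hρ'Qμ hδ
    rw [empiricalMeasure_apply hn x (Finset.measurableSet _).compl]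
    simp [frequency]
  · obtain ⟨j, hj⟩ := hcell z
    have h1 : ρ z - ρ' z = ρ z * ((p j - q j) / p j) := by
      rw [hρ'Q j z hj, sub_div, div_self (hQpos j).ne']; ring
    have h2 : |(p j - q j) / p j| ≤ τ := by
      rw [abs_div, abs_of_pos (hQpos j), div_le_iff₀ (hQpos j), abs_sub_comm]
      exact hτ j
    rw [h1, abs_mul, abs_of_nonneg (hρ0 z)]
    exact mul_le_mul (hρmax z) h2 (abs_nonneg _) ((hρ0 z).trans (hρmax z))

end Rescaling

/-! ### Concentration over a partition of the manifold -/

lemma exists_densityMeasure_ball_ge {m d : ℕ} {M : Type*} [TopologicalSpace M]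
    [ChartedSpace (EuclideanSpace ℝ (Fin m)) M] [IsManifold (𝓡 m) ∞ M] [CompactSpace M]
    [MeasurableSpace M] [BorelSpace M] {ι : M → EuclideanSpace ℝ (Fin d)}
    (hι : IsSmoothEmbedding (𝓡 m) (𝓡 d) ∞ ι) {ρ : M → ℝ} {ρmin : ℝ} (hρmin : 0 < ρmin)
    (hρ : ∀ x, ρmin ≤ ρ x) (hprob : IsProbabilityMeasure (densityMeasure m ι ρ)) :
    ∃ c > (0 : ℝ), ∃ r > (0 : ℝ), ∀ x, ∀ s, 0 < s → s ≤ r →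
      c * s ^ m ≤ (densityMeasure m ι ρ).real
        {y | geodesicEDist (m := m) ι x y < ENNReal.ofReal s} := by
  obtain ⟨c, hc, r, hr, h⟩ := exists_volM_ball_ge hι
  refine ⟨ρmin * c, by positivity, r, hr, fun x s hs hsr => ?_⟩
  rw [measureReal_def, ← ENNReal.ofReal_le_iff_le_toReal (measure_ne_top _ _), mul_assoc,
    ENNReal.ofReal_mul hρmin.le]
  refine (mul_le_mul_right (h x s hs hsr) _).trans (le_trans ?_ (withDensity_apply_le _ _))
  rw [← setLIntegral_const]
  exact lintegral_mono fun y => ENNReal.ofReal_le_ofReal (hρ y)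

end EmpiricalTransport

theorem proposition1 {m d : ℕ} (hm : 1 ≤ m)
    {M : Type*} [TopologicalSpace M] [ChartedSpace (EuclideanSpace ℝ (Fin m)) M]
    [IsManifold (𝓡 m) ∞ M] [CompactSpace M] [ConnectedSpace M]
    [MeasurableSpace M] [BorelSpace M]
    (ι : M → EuclideanSpace ℝ (Fin d)) (hι : IsSmoothEmbedding (𝓡 m) (𝓡 d) ∞ ι)
    (ρ : M → ℝ) (ρmin ρmax : ℝ) (hρmin : 0 < ρmin) (hρ : ∀ x, ρmin ≤ ρ x ∧ ρ x ≤ ρmax)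
    (α : ℝ≥0) (hα : 0 < α ∧ α ≤ 1) (hρα : EmpiricalTransport.IsC2Holder m α ρ)
    (hprob : IsProbabilityMeasure (EmpiricalTransport.densityMeasure m ι ρ))
    (A : ℝ) (hA : 0 < A) :
    ∃ c > (0 : ℝ), ∃ C > (0 : ℝ), ∀ n : ℕ, 2 ≤ n → ∀ θ δ : ℝ, 0 < θ →
      1 / (n : ℝ) ^ (1 / (m : ℝ)) < δ → A * (θ + δ) ≤ ρmin / 2 →
      ∀ {Ω : Type*} [MeasurableSpace Ω] (P : Measure Ω) [IsProbabilityMeasure P]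
        (X : Fin n → Ω → M), (∀ i, Measurable (X i)) → iIndepFun X P →
        (∀ i, Measure.map (X i) P = EmpiricalTransport.densityMeasure m ι ρ) →
      ∃ E : Set Ω, MeasurableSet E ∧
        1 - (n : ℝ) * Real.exp (-(c * n * θ ^ 2 * δ ^ m)) < P.real E ∧
        ∀ w ∈ E, ∃ ρ' : M → ℝ, Measurable ρ' ∧ (∀ x, 0 ≤ ρ' x) ∧
          IsProbabilityMeasure (EmpiricalTransport.densityMeasure m ι ρ') ∧
          (∃ r : ℝ≥0∞,
            IsLeast (EmpiricalTransport.maxDisplacement (m := m) ι ''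
              {T : M → M | EmpiricalTransport.IsTransportMap
                (EmpiricalTransport.densityMeasure m ι ρ')
                (EmpiricalTransport.empiricalMeasure fun i => X i w) T}) r ∧
            r ≤ ENNReal.ofReal δ) ∧
          eLpNorm (fun x => ρ x - ρ' x) ⊤ (EmpiricalTransport.densityMeasure m ι ρ)
            ≤ ENNReal.ofReal (C * (θ + δ)) := by
  classical
  have hDm : ∀ y, Measurable fun x => EmpiricalTransport.geodesicEDist (m := m) ι x y :=
    EmpiricalTransport.measurable_geodesicEDist hι
  have hρm : Measurable ρ := hρα.measurable
  have hρ0 : ∀ x, 0 ≤ ρ x := fun x => hρmin.le.trans (hρ x).1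
  have : T2Space M := hι.isEmbedding.t2Space
  have hvol := EmpiricalTransport.isDiffuse_volM hm hι
  obtain ⟨c₀, hc₀, r₀, hr₀, hball⟩ :=
    EmpiricalTransport.exists_densityMeasure_ball_ge hι hρmin (fun x => (hρ x).1) hprob
  obtain ⟨x₀⟩ : Nonempty M := inferInstance
  have hρmax : 0 < ρmax := hρmin.trans_le ((hρ x₀).1.trans (hρ x₀).2)
  -- `Δ` bounds both `θ` and `δ`. Cells of radius `s = lam * δ` have diameter at most `δ` and lie in
  -- the range of the volume bound; deviations `κ * θ ≤ 2` lie in the range of Chernoff's bound.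
  set Δ := ρmin / (2 * A) with hΔ
  have hΔ0 : 0 < Δ := by positivity
  set lam := min (1 / 4) (r₀ / Δ) with hlam
  have hlam0 : 0 < lam := by positivity
  set c₁ := c₀ * lam ^ m with hc₁
  have hc₁0 : 0 < c₁ := by positivity
  set κ := min 1 (2 / Δ) with hκ
  have hκ0 : 0 < κ := by positivity
  obtain ⟨c, hc, habsorb⟩ := EmpiricalTransport.exists_rate_absorb
    (a := 2 / c₁) (b := c₁ * κ ^ 2 / 4) (by positivity) (by positivity)
  refine ⟨c, hc, ρmax, hρmax, fun n hn θ δ hθ hδn hA' Ω _ P _ Y hY hind hlaw => ?_⟩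
  have hn0 : (0 : ℝ) < n := by positivity
  have hδ0 : 0 < δ := lt_of_le_of_lt (by positivity) hδn
  have hδm : 1 / (n : ℝ) < δ ^ m := by
    have h1 := pow_lt_pow_left₀ hδn (by positivity) (by omega : m ≠ 0)
    rwa [div_pow, one_pow, one_div (m : ℝ), Real.rpow_inv_natCast_pow hn0.le (by omega)] at h1
  have hsum : θ + δ ≤ Δ := by
    rw [hΔ, le_div_iff₀ (by positivity)]; linarith
  have hrate : c * n * θ ^ 2 * δ ^ m = c * (n * θ ^ 2 * δ ^ m) := by ring
  rw [hrate]
  rcases habsorb (n * θ ^ 2 * δ ^ m) (by positivity) with hlarge | hsmall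
  swap
  · refine ⟨∅, .empty, ?_, by simp⟩
    have h2n : (2 : ℝ) ≤ n := by exact_mod_cast hn
    have h1 := mul_le_mul_of_nonneg_right h2n
      (Real.exp_nonneg (-(c * (n * θ ^ 2 * δ ^ m))))
    simp only [measureReal_empty]
    linarith
  set μ := EmpiricalTransport.densityMeasure m ι ρ with hμ
  have hs0 : 0 < lam * δ := by positivity
  have hsr : lam * δ ≤ r₀ := by
    calc lam * δ ≤ r₀ / Δ * Δ := mul_le_mul (min_le_right _ _) (by linarith) hδ0.le (by positivity)
      _ = r₀ := div_mul_cancel₀ _ hΔ0.ne'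
  have hs4 : 4 * (lam * δ) ≤ δ := by
    have := mul_le_mul_of_nonneg_right (min_le_left (1 / 4) (r₀ / Δ)) hδ0.le
    linarith
  have hv : c₀ * (lam * δ) ^ m = c₁ * δ ^ m := by rw [hc₁, mul_pow, mul_assoc]
  obtain ⟨N, Q, hNv, hQ, hQd, hQu, hQv, hQδ⟩ := EmpiricalTransport.exists_partition (μ := μ)
    (EmpiricalTransport.geodesicEDist_self (m := m) ι) (EmpiricalTransport.geodesicEDist_comm ι)
    (EmpiricalTransport.geodesicEDist_triangle ι) hDm hs0 (v := c₁ * δ ^ m) (by positivity)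
    (fun x => hv ▸ hball x _ hs0 hsr)
  have hκθ : κ * θ ≤ 2 := by
    calc κ * θ ≤ 2 / Δ * Δ := mul_le_mul (min_le_right _ _) (by linarith) hθ.le (by positivity)
      _ = 2 := div_mul_cancel₀ _ hΔ0.ne'
  let bad : Fin N → Set Ω := fun j => {w | κ * θ * μ.real (Q j) <
    |EmpiricalTransport.frequency (fun i => Y i w) (Q j) - μ.real (Q j)|}
  have hbadm : ∀ j, MeasurableSet (bad j) := fun j =>
    measurableSet_lt measurable_const
      (((EmpiricalTransport.measurable_frequency hY (hQ j)).sub_const _).abs)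
  have hbad : ∀ j, P.real (bad j) ≤
      2 * Real.exp (-(c₁ * κ ^ 2 / 4 * (n * θ ^ 2 * δ ^ m))) := fun j => by
    refine (EmpiricalTransport.measure_frequency_sub_gt_le (by omega) hY hind hlaw (hQ j)
      (by positivity) hκθ).trans (mul_le_mul_of_nonneg_left (Real.exp_le_exp.2 ?_) two_pos.le)
    have h1 := mul_le_mul_of_nonneg_left (hQv j) (show 0 ≤ n * (κ * θ) ^ 2 / 4 by positivity)
    rw [neg_le_neg_iff]
    refine le_trans (le_of_eq ?_) (h1.trans (le_of_eq ?_)) <;> ring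
  have hN : (N : ℝ) ≤ n / c₁ := by
    rw [le_div_iff₀ hc₁0]
    have h1 : 1 < δ ^ m * n := by rwa [div_lt_iff₀ hn0] at hδm
    have h2 : (N : ℝ) * c₁ * 1 ≤ N * c₁ * (δ ^ m * n) :=
      mul_le_mul_of_nonneg_left h1.le (by positivity)
    have h3 := mul_le_mul_of_nonneg_right hNv hn0.le
    linarith
  have hUnion : P.real (⋃ j, bad j) < n * Real.exp (-(c * (n * θ ^ 2 * δ ^ m))) := by
    set ε := Real.exp (-(c₁ * κ ^ 2 / 4 * (n * θ ^ 2 * δ ^ m)))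
    calc P.real (⋃ j, bad j) ≤ ∑ j, P.real (bad j) := measureReal_iUnion_fintype_le _
      _ ≤ ∑ _j : Fin N, 2 * ε := Finset.sum_le_sum fun j _ => hbad j
      _ = N * (2 * ε) := by simp
      _ ≤ n / c₁ * (2 * ε) := mul_le_mul_of_nonneg_right hN (by positivity)
      _ = n * (2 / c₁ * ε) := by ring
      _ < n * Real.exp (-(c * (n * θ ^ 2 * δ ^ m))) := mul_lt_mul_of_pos_left hlarge hn0
  refine ⟨(⋃ j, bad j)ᶜ, (MeasurableSet.iUnion hbadm).compl, ?_, fun w hw => ?_⟩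
  · rw [probReal_compl_eq_one_sub (MeasurableSet.iUnion hbadm)]
    linarith
  have hgood : ∀ j, |EmpiricalTransport.frequency (fun i => Y i w) (Q j) - μ.real (Q j)| ≤
      κ * θ * μ.real (Q j) := fun j => not_lt.1 fun h => hw (Set.mem_iUnion.2 ⟨j, h⟩)
  obtain ⟨ρ', hρ'm, hρ'0, hρ'p, ⟨r, hr, hrδ⟩, hρρ'⟩ :=
    EmpiricalTransport.exists_density_of_partition hvol
      (EmpiricalTransport.geodesicEDist_self (m := m) ι) hDm hρm hρ0 (fun x => (hρ x).2) hQ hQd hQu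
      (fun j => lt_of_lt_of_le (by positivity) (hQv j)) hQδ (by omega) (fun i => Y i w) hgood
  refine ⟨ρ', hρ'm, hρ'0, hρ'p, ⟨r, hr, hrδ.trans (ENNReal.ofReal_le_ofReal hs4)⟩, ?_⟩
  refine (eLpNorm_le_of_ae_bound (C := ρmax * (θ + δ)) (.of_forall fun z => ?_)).trans (by simp)
  rw [Real.norm_eq_abs]
  refine (hρρ' z).trans (mul_le_mul_of_nonneg_left ?_ hρmax.le)
  calc κ * θ ≤ 1 * θ := mul_le_mul_of_nonneg_right (min_le_left _ _) hθ.le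
    _ ≤ θ + δ := by linarith
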